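/- Let $C_n$ $(n\ge 3)$ denote the $n$-vertex cycle; a *cycle* is a graph isomorphic to some $C_n$. For a graph $H$ and an integer $k\ge 1$, the power $H^k$ has the vertex set of $H$, with two distinct vertices adjacent if and only if their distance in $H$ is at most $k$. Let $\omega(H)$ and $\alpha(H)$ denote the clique number and the independence number of $H$, and let $\mathcal I_H^{(r)}$ be the family of independent sets of $H$ of size $r$. A family of sets is *intersecting* if $A\cap B\neq\emptyset$ for all members $A,B$ of it. For a vertex $x$ of $H$, the *star* with centre $x$ is $\mathcal I_H^{(r)}(x)=\{A\in\mathcal I_H^{(r)} : x\in A\}$. The graph $H$ is *$r$-EKR* if at least one of the largest intersecting subfamilies of $\mathcal I_H^{(r)}$ is a star $\mathcal I_H^{(r)}(x)$ with $x\in V(H)$. **Theorem.** Let $s\ge 0$, let ${}_*C,{}_1C,\dots,{}_sC$ be cycles, let $k^*,k_1,\dots,k_s\ge 1$ be integers, and let $G$ be the disjoint union of ${}_*C^{\,k^*},{}_1C^{\,k_1},\dots,{}_sC^{\,k_s}$. Suppose that $$\omega({}_iC^{\,k_i})>2k^*+1\qquad\text{for every } 1\le i\le s$$ (no condition if $s=0$).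 Then for every integer $r$ with $1\le r\le\alpha(G)$, the graph $G$ is $r$-EKR; moreover, for every $x\in V({}_*C)$, the star $\mathcal I_G^{(r)}(x)$ is a largest intersecting subfamily of $\mathcal I_G^{(r)}$. -/

import Mathlib

open scoped SimpleGraph

namespace CyclePowerEKR

universe u v

/-- The `k`-th power of a graph: distinct vertices are adjacent when they are joined by a path
and their distance is at most `k`. (`SimpleGraph.dist` is `0` exactly for equal vertices and for
vertices in different components, so `1 ≤ dist` excludes both.) -/
def power {V : Type u} (G : SimpleGraph V) (k : ℕ) : SimpleGraph V where
  Adj v w := 1 ≤ G.dist v w ∧ G.dist v w ≤ k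
  symm := ⟨fun v w h => by rwa [G.dist_comm] at h⟩
  loopless := ⟨fun v h => by simp at h⟩

/-- `G` is a cycle: a copy of `C_n` for some `n ≥ 3`. -/
def IsCycle {V : Type u} (G : SimpleGraph V) : Prop :=
  ∃ n : ℕ, 3 ≤ n ∧ Nonempty (G ≃g SimpleGraph.cycleGraph n)

/-- The disjoint union of a family of graphs: the union of their copies in the disjoint union of
the vertex sets. -/
def disjointUnion {ι : Type u} {V : ι → Type v} (G : ∀ i, SimpleGraph (V i)) :
    SimpleGraph (Σ i, V i) :=
  ⨆ i, (G i).map (Function.Embedding.sigmaMk i)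

/-- The family of independent `r`-element sets of `G`. -/
def indepFamily {V : Type u} (G : SimpleGraph V) (r : ℕ) : Set (Finset V) :=
  {A | G.IsIndepSet (A : Set V) ∧ A.card = r}

/-- A family of sets is intersecting if any two of its members (also a member and itself) have a
common element. -/
def IsIntersecting {V : Type u} (𝒜 : Set (Finset V)) : Prop :=
  ∀ A ∈ 𝒜, ∀ B ∈ 𝒜, ∃ x, x ∈ A ∧ x ∈ B

/-- The star of `ℱ` with centre `x`. -/
def starAt {V : Type u} (ℱ : Set (Finset V)) (x : V) : Set (Finset V) :=
  {A | A ∈ ℱ ∧ x ∈ A}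

/-- `𝒜` is a largest intersecting subfamily of `ℱ`. -/
def IsLargestIntersecting {V : Type u} (ℱ 𝒜 : Set (Finset V)) : Prop :=
  𝒜 ⊆ ℱ ∧ IsIntersecting 𝒜 ∧
    ∀ ℬ : Set (Finset V), ℬ ⊆ ℱ → IsIntersecting ℬ → ℬ.encard ≤ 𝒜.encard

/-- `ℱ` has the star property: one of its largest intersecting subfamilies is a star. -/
def HasStarProperty {V : Type u} (ℱ : Set (Finset V)) : Prop :=
  ∃ x : V, IsLargestIntersecting ℱ (starAt ℱ x)

/-- `G` is `r`-EKR. -/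
def IsEKR {V : Type u} (G : SimpleGraph V) (r : ℕ) : Prop :=
  HasStarProperty (indepFamily G r)

end CyclePowerEKR

/-!
The vertices of the distinguished cycle are numbered `0, …, n - 1` so that the given centre is `0`,
and an independent set of `G` is recorded as a pair `(P, Q)`: its part `P` in the power of the
cycle, a set of numbers that are pairwise more than `k` apart around the cycle, and its part `Q` in
the union `H` of the other components. About `H` only one fact is used: it has an automorphism `ρ`,
the simultaneous rotation of its cycles by one vertex, such that `ρ, …, ρ ^ (2 * k + 1)` move every
vertex to a neighbour. This is what the assumption on the clique numbers provides
(`IsCycle.exists_rotation`), because the power of a cycle is complete or has clique number at most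
one more than its exponent (`card_le_of_isClique_power`). It follows that an independent set of `H`
is disjoint from its first `2 * k + 1` translates.

An intersecting family is compared with the star at `0` by induction on `n`
(`encard_le_jointStar`).

If `n ≤ 2 * k + 1`, then `P` has at most one element, and the star corresponds to all independent
`(r - 1)`-sets of `H`. The family is mapped there by `({i}, Q) ↦ ρ ^ (i + 1) Q`. Disjointness of
translates makes this injective, and keeps the image away from the shadow of the family of the `Q`
for which `(∅, Q)` is a member. By Katona's theorem this shadow is at least as large as the family
of those `Q` (`card_le_card_shadow`), which settles this case (`encard_le_jointStar_of_le`).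

If `n ≥ 2 * k + 2`, then Talbot's compression applies. Contracting the edge between `n - 1` and `0`
turns most of the family into an intersecting family for the cycle of length `n - 1`. The members
for which this fails, because two elements come too close or because the image arises already from
another member, contain exactly one of the `k + 1` vertices `n - k - 1, …, n - 1`. Deleting these
vertices sends them injectively to an intersecting family of `(r - 1)`-sets for the cycle of length
`n - k - 1` (`truncate_injOn`, `truncate_meets`). The sizes of stars satisfy the corresponding
recurrence (`jointStar_add_le`).
-/

/-! ### Shadows of intersecting families -/

namespace CyclePowerEKR

open Finset
open scoped FinsetFamily

/-- If the numbers `∑ c B`, over the members `B` of a uniform family that contain a given set `T`,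
vanish for all `T` of size `m`, then they vanish for all smaller sets `S`: the sum for `S` is,
up to a positive factor, the sum of those for the sets `insert x S`. -/
theorem sum_superset_eq_zero {W : Type*} [Fintype W] [DecidableEq W] {𝒜 : Finset (Finset W)}
    {m : ℕ} (h𝒜 : (𝒜 : Set (Finset W)).Sized (m + 1)) (c : Finset W → ℚ)
    (hc : ∀ T : Finset W, #T = m → ∑ B ∈ 𝒜, (if T ⊆ B then c B else 0) = 0) :
    ∀ (d : ℕ) (S : Finset W), #S + d = m → ∑ B ∈ 𝒜, (if S ⊆ B then c B else 0) = 0 := by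
  intro d
  induction d with
  | zero => exact fun S hS => hc S hS
  | succ d ih =>
    intro S hS
    have h1 : ∑ x ∈ Sᶜ, ∑ B ∈ 𝒜, (if insert x S ⊆ B then c B else 0) = 0 := by
      refine Finset.sum_eq_zero fun x hx => ih _ ?_
      rw [card_insert_of_notMem (by simpa using hx)]
      omega
    rw [Finset.sum_comm] at h1
    have h2 : ∀ B ∈ 𝒜, ∑ x ∈ Sᶜ, (if insert x S ⊆ B then c B else 0)
        = ((d + 2 : ℕ) : ℚ) * (if S ⊆ B then c B else 0) := by
      intro B hB
      by_cases hSB : S ⊆ B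
      · have h3 : ∀ x ∈ Sᶜ, (if insert x S ⊆ B then c B else 0) = if x ∈ B then c B else 0 := by
          intro x _
          simp [insert_subset_iff, hSB]
        have h4 : #(B \ S) = d + 2 := by
          rw [card_sdiff_of_subset hSB, h𝒜 hB]
          omega
        have h5 : Sᶜ.filter (· ∈ B) = B \ S := by
          ext x
          simp [and_comm]
        rw [Finset.sum_congr rfl h3, ← Finset.sum_filter, h5, Finset.sum_const, h4, if_pos hSB,
          nsmul_eq_mul]
      · rw [if_neg hSB, mul_zero]
        refine Finset.sum_eq_zero fun x _ => if_neg fun h => hSB ((subset_insert _ _).trans h)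
    rw [Finset.sum_congr rfl h2, ← Finset.mul_sum] at h1
    exact (mul_eq_zero.mp h1).resolve_left (by positivity)

/-- Katona's shadow theorem for intersecting families. The incidence vectors of the members over
the shadow are linearly independent: a linear relation `c` between them has
`∑ c B = 0` over the `B ⊇ S`, for every `S` with less than `m + 1` elements, and the alternating
sum of these relations over the proper subsets `S` of a member `A` leaves only `c A`, because
`A ∩ B` is nonempty for all `B`. -/
theorem card_le_card_shadow {W : Type*} [Fintype W] [DecidableEq W] {𝒜 : Finset (Finset W)}
    {m : ℕ} (h𝒜 : (𝒜 : Set (Finset W)).Sized (m + 1))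
    (hint : ∀ A ∈ 𝒜, ∀ B ∈ 𝒜, (A ∩ B).Nonempty) : #𝒜 ≤ #(∂ 𝒜) := by
  let v : 𝒜 → (∂ 𝒜 → ℚ) := fun B T => if T.1 ⊆ B.1 then 1 else 0
  have hv : LinearIndependent ℚ v := by
    rw [Fintype.linearIndependent_iff]
    intro g hg
    -- The coefficients of the relation, extended by zero to all sets.
    let c : Finset W → ℚ := fun B => if h : B ∈ 𝒜 then g ⟨B, h⟩ else 0
    have hc : ∀ T : Finset W, #T = m → ∑ B ∈ 𝒜, (if T ⊆ B then c B else 0) = 0 := by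
      intro T hT
      by_cases hT' : T ∈ ∂ 𝒜
      · have h1 := congrFun hg ⟨T, hT'⟩
        simp only [Finset.sum_apply, Pi.smul_apply, v, smul_eq_mul, mul_ite, mul_one, mul_zero,
          Pi.zero_apply] at h1
        refine Eq.trans ?_ h1
        rw [← Finset.sum_coe_sort 𝒜]
        refine Finset.sum_congr rfl fun B _ => ?_
        simp [c]
      · refine Finset.sum_eq_zero fun B hB => if_neg fun h => hT' ?_
        exact mem_shadow_iff_exists_mem_card_add_one.mpr ⟨B, hB, h, by rw [h𝒜 hB, hT]⟩
    have hS := sum_superset_eq_zero h𝒜 c hc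
    rintro ⟨A, hA⟩
    have h1 : ∑ S ∈ A.ssubsets, (-1 : ℚ) ^ #S * ∑ B ∈ 𝒜, (if S ⊆ B then c B else 0) = 0 := by
      refine Finset.sum_eq_zero fun S hSA => ?_
      have h2 := card_lt_card (mem_ssubsets.mp hSA)
      rw [h𝒜 hA] at h2
      rw [hS (m - #S) S (by omega), mul_zero]
    simp only [Finset.mul_sum] at h1
    rw [Finset.sum_comm, Finset.sum_eq_single A] at h1
    · have h3 : ∑ S ∈ A.ssubsets, (-1 : ℚ) ^ #S * (if S ⊆ A then c A else 0)
          = (∑ S ∈ A.ssubsets, (-1 : ℚ) ^ #S) * c A := by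
        rw [Finset.sum_mul]
        refine Finset.sum_congr rfl fun S hSA => ?_
        rw [if_pos (mem_ssubsets.mp hSA).1]
      have h4 : ∑ S ∈ A.powerset, (-1 : ℚ) ^ #S = 0 := by
        have h := sum_powerset_neg_one_pow_card_of_nonempty (x := A) (by simpa using hint A hA A hA)
        exact_mod_cast h
      have h5 : ∑ S ∈ A.ssubsets, (-1 : ℚ) ^ #S = -(-1) ^ #A := by
        rw [ssubsets, ← Finset.add_sum_erase _ _ (mem_powerset_self A)] at *
        linarith
      rw [h3, h5] at h1
      have h6 : c A = 0 := (mul_eq_zero.mp h1).resolve_left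
        (neg_ne_zero.mpr (pow_ne_zero _ (by norm_num)))
      simpa [c, hA] using h6
    · intro B hB hBA
      have hAB : ¬ A ⊆ B := fun h => hBA (eq_of_subset_of_card_le h (by rw [h𝒜 hA, h𝒜 hB])).symm
      have h3 : A.ssubsets.filter (· ⊆ B) = (A ∩ B).powerset := by
        ext S
        simp only [mem_filter, mem_ssubsets, mem_powerset, subset_inter_iff,
          Finset.ssubset_iff_subset_ne]
        constructor
        · exact fun h => ⟨h.1.1, h.2⟩
        · exact fun h => ⟨⟨h.1, fun e => hAB (e ▸ h.2)⟩, h.2⟩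
      have h4 : ∑ S ∈ (A ∩ B).powerset, (-1 : ℚ) ^ #S = 0 := by
        have h := sum_powerset_neg_one_pow_card_of_nonempty (hint A hA B hB)
        exact_mod_cast h
      simp only [mul_ite, mul_zero]
      rw [← Finset.sum_filter, h3, ← Finset.sum_mul, h4, zero_mul]
    · exact fun h => absurd hA h
  simpa using hv.fintype_card_le_finrank

end CyclePowerEKR

/-! ### Separated sets -/

namespace CyclePowerEKR

/-- `P` is an independent set of the `k`-th power of the cycle with vertices `0, …, n - 1`: any two
elements are more than `k` apart, both ways around the cycle. -/
def Sep (n k : ℕ) (P : Finset ℕ) : Prop :=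
  (∀ a ∈ P, a < n) ∧ ∀ a ∈ P, ∀ b ∈ P, a < b → a + k < b ∧ b + k < a + n

/-- The independent `r`-sets of the disjoint union of the `k`-th power of the `n`-vertex cycle and
`H`, each recorded as the pair of its parts in the two graphs. -/
def jointFamily {W : Type*} (H : SimpleGraph W) (n k r : ℕ) : Set (Finset ℕ × Finset W) :=
  {A | Sep n k A.1 ∧ H.IsIndepSet (A.2 : Set W) ∧ A.1.card + A.2.card = r}

/-- The star of `jointFamily` whose centre is the vertex `0` of the cycle. -/
def jointStar {W : Type*} (H : SimpleGraph W) (n k r : ℕ) : Set (Finset ℕ × Finset W) :=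
  {A | A ∈ jointFamily H n k r ∧ 0 ∈ A.1}

/-- The sets recorded by two pairs have a common element. -/
def Meets {W : Type*} (A B : Finset ℕ × Finset W) : Prop :=
  (∃ x, x ∈ A.1 ∧ x ∈ B.1) ∨ ∃ y, y ∈ A.2 ∧ y ∈ B.2

theorem Sep.eq_of_le {n k : ℕ} {P : Finset ℕ} (h : Sep n k P) (hn : n ≤ 2 * k + 1) {a b : ℕ}
    (ha : a ∈ P) (hb : b ∈ P) : a = b := by
  rcases lt_trichotomy a b with hab | hab | hab
  · have := h.2 a ha b hb hab
    omega
  · exact hab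
  · have := h.2 b hb a ha hab
    omega

theorem sep_singleton {n k a : ℕ} (h : a < n) : Sep n k {a} := by
  constructor
  · simpa using h
  · intro x hx y hy hxy
    simp only [Finset.mem_singleton] at hx hy
    omega

/-! ### Cycle powers that are complete graphs -/

/-- The case in which the power of the cycle is a complete graph. The pairs `({i}, Q)` are sent to
the translates of `Q` by `ρ ^ (i + 1)`, the pairs `(∅, Q)` provide the shadow of the family of
those `Q`. Since an independent set of `H` is disjoint from its translates by
`ρ, …, ρ ^ (2 * k + 1)`, no `(r - 1)`-set arises twice, except that several `Q` may share
an element of their shadow, where Katona's theorem applies. -/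
theorem encard_le_jointStar_of_le {W : Type*} [Finite W] {H : SimpleGraph W} {n k r : ℕ}
    (ρ : Equiv.Perm W) (hρ : ∀ a b, H.Adj (ρ a) (ρ b) ↔ H.Adj a b)
    (hadj : ∀ v j, 1 ≤ j → j ≤ 2 * k + 1 → H.Adj v ((ρ ^ j) v))
    (hn1 : 1 ≤ n) (hn : n ≤ 2 * k + 1) {𝒜 : Set (Finset ℕ × Finset W)}
    (h𝒜 : 𝒜 ⊆ jointFamily H n k r) (hint : ∀ A ∈ 𝒜, ∀ B ∈ 𝒜, Meets A B) :
    𝒜.encard ≤ (jointStar H n k r).encard := by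
  classical
  have := Fintype.ofFinite W
  have hρj : ∀ (j : ℕ) a b, H.Adj ((ρ ^ j) a) ((ρ ^ j) b) ↔ H.Adj a b := by
    intro j
    induction j with
    | zero => simp
    | succ j ih =>
      intro a b
      rw [pow_succ', Equiv.Perm.mul_apply, Equiv.Perm.mul_apply, hρ, ih]
  let 𝒯 : Set (Finset W) := {Q | H.IsIndepSet (Q : Set W) ∧ Q.card + 1 = r}
  have h𝒯 : 𝒯.encard ≤ (jointStar H n k r).encard := by
    refine Set.encard_le_encard_of_injOn (f := fun Q => (({0} : Finset ℕ), Q)) ?_ ?_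
    · rintro Q ⟨hQ, hQr⟩
      refine ⟨⟨sep_singleton (by omega), hQ, ?_⟩, by simp⟩
      simp only [Finset.card_singleton]
      omega
    · intro Q _ Q' _ h
      exact (Prod.mk.inj h).2
  refine le_trans ?_ h𝒯
  let 𝒜₀ : Set (Finset ℕ × Finset W) := {A ∈ 𝒜 | A.1 = ∅}
  let 𝒜₁ : Set (Finset ℕ × Finset W) := {A ∈ 𝒜 | A.1 ≠ ∅}
  let ℬ : Finset (Finset W) := Finset.univ.filter fun Q => (∅, Q) ∈ 𝒜
  let f : Finset ℕ × Finset W → Finset W :=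
    fun A => A.2.map (ρ ^ (A.1.sup id + 1)).toEmbedding
  have hsingle : ∀ A ∈ 𝒜₁, ∃ i < n, A.1 = {i} ∧ f A = A.2.map (ρ ^ (i + 1)).toEmbedding := by
    rintro A ⟨hA, hA1⟩
    obtain ⟨i, hi⟩ := Finset.nonempty_iff_ne_empty.mpr hA1
    have h1 : A.1 = {i} :=
      Finset.eq_singleton_iff_unique_mem.mpr ⟨hi, fun x hx => (h𝒜 hA).1.eq_of_le hn hx hi⟩
    exact ⟨i, (h𝒜 hA).1.1 i hi, h1, by simp [f, h1]⟩
  -- An independent set contains no vertex together with its image under a short rotation.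
  have hfree : ∀ Q : Finset W, H.IsIndepSet (Q : Set W) → ∀ y ∈ Q, ∀ j, 1 ≤ j → j ≤ 2 * k + 1 →
      (ρ ^ j) y ∉ Q := by
    intro Q hQ y hy j hj1 hj hmem
    exact hQ hy hmem (hadj y j hj1 hj).ne (hadj y j hj1 hj)
  have hmaps : f '' 𝒜₁ ⊆ 𝒯 := by
    rintro _ ⟨A, hA, rfl⟩
    obtain ⟨i, -, h1, h2⟩ := hsingle A hA
    obtain ⟨-, hind, hcard⟩ := h𝒜 hA.1
    rw [h2]
    constructor
    · intro a ha b hb hab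
      simp only [Finset.coe_map, Set.mem_image, Finset.mem_coe, Equiv.coe_toEmbedding] at ha hb
      obtain ⟨a', ha', rfl⟩ := ha
      obtain ⟨b', hb', rfl⟩ := hb
      rw [hρj]
      exact hind ha' hb' fun e => hab (by rw [e])
    · rw [Finset.card_map, ← hcard, h1, Finset.card_singleton, add_comm]
  have hne : ∀ A ∈ 𝒜₁, ∀ B ∈ 𝒜₁, ∀ i i', A.1 = {i} → B.1 = {i'} → i' < n → i < i' →
      A.2.map (ρ ^ (i + 1)).toEmbedding ≠ B.2.map (ρ ^ (i' + 1)).toEmbedding := by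
    intro A hA B hB i i' h1 h2 hi' hii' he
    rcases hint A hA.1 B hB.1 with ⟨x, hx, hx'⟩ | ⟨y, hy, hy'⟩
    · simp only [h1, h2, Finset.mem_singleton] at hx hx'
      omega
    · have h3 : (ρ ^ (i' + 1)) y ∈ A.2.map (ρ ^ (i + 1)).toEmbedding := by
        rw [he]
        exact Finset.mem_map_of_mem _ hy'
      obtain ⟨z, hz, hz'⟩ := Finset.mem_map.mp h3
      have h4 : i' + 1 = (i + 1) + (i' - i) := by omega
      rw [h4, pow_add ρ (i + 1) (i' - i), Equiv.coe_toEmbedding, Equiv.Perm.mul_apply] at hz'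
      have h5 := (ρ ^ (i + 1)).injective hz'
      exact hfree A.2 (h𝒜 hA.1).2.1 y hy (i' - i) (by omega) (by omega) (h5 ▸ hz)
  have hinj : Set.InjOn f 𝒜₁ := by
    intro A hA B hB hAB
    obtain ⟨i, hi, h1, h2⟩ := hsingle A hA
    obtain ⟨i', hi', h1', h2'⟩ := hsingle B hB
    rw [h2, h2'] at hAB
    rcases lt_trichotomy i i' with h | h | h
    · exact absurd hAB (hne A hA B hB i i' h1 h1' hi' h)
    · subst h
      exact Prod.ext (h1.trans h1'.symm) (Finset.map_injective _ hAB)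
    · exact absurd hAB.symm (hne B hB A hA i' i h1' h1 hi h)
  have hℬ : ∀ B ∈ ℬ, ((∅ : Finset ℕ), B) ∈ 𝒜 := fun B hB => by simpa [ℬ] using hB
  have hsh : ((ℬ.shadow : Finset (Finset W)) : Set (Finset W)) ⊆ 𝒯 := by
    intro Q hQ
    obtain ⟨B, hB, hQB, hc⟩ := Finset.mem_shadow_iff_exists_mem_card_add_one.mp hQ
    obtain ⟨-, hind, hcard⟩ := h𝒜 (hℬ B hB)
    refine ⟨hind.mono (by exact_mod_cast hQB), ?_⟩
    simp only [Finset.card_empty] at hcard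
    omega
  have hdisj : Disjoint ((ℬ.shadow : Finset (Finset W)) : Set (Finset W)) (f '' 𝒜₁) := by
    rw [Set.disjoint_left]
    rintro _ hQ ⟨A, hA, rfl⟩
    obtain ⟨B, hB, hQB⟩ := Finset.exists_subset_of_mem_shadow hQ
    obtain ⟨i, hi, h1, h2⟩ := hsingle A hA
    rcases hint A hA.1 _ (hℬ B hB) with ⟨x, -, hx⟩ | ⟨y, hy, hy'⟩
    · simp at hx
    · refine hfree B (h𝒜 (hℬ B hB)).2.1 y hy' (i + 1) (by omega) (by omega) (hQB ?_)
      rw [h2]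
      exact Finset.mem_map_of_mem (ρ ^ (i + 1)).toEmbedding hy
  have hcard : 𝒜₀.encard ≤ ((ℬ.shadow : Finset (Finset W)) : Set (Finset W)).encard := by
    have h1 : 𝒜₀.encard ≤ (ℬ : Set (Finset W)).encard := by
      refine Set.encard_le_encard_of_injOn (f := Prod.snd) ?_ ?_
      · rintro ⟨P, Q⟩ ⟨hA, rfl : P = ∅⟩
        simpa [ℬ] using hA
      · rintro ⟨P, Q⟩ ⟨hA, rfl : P = ∅⟩ ⟨P', Q'⟩ ⟨hA', rfl : P' = ∅⟩ h
        exact Prod.ext rfl h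
    refine h1.trans ?_
    rw [Set.encard_coe_eq_coe_finsetCard, Set.encard_coe_eq_coe_finsetCard]
    have hmeet : ∀ A ∈ ℬ, ∀ B ∈ ℬ, (A ∩ B).Nonempty := by
      intro A hA B hB
      rcases hint _ (hℬ A hA) _ (hℬ B hB) with ⟨x, hx, -⟩ | ⟨y, hy, hy'⟩
      · simp at hx
      · exact ⟨y, Finset.mem_inter.mpr ⟨hy, hy'⟩⟩
    rcases ℬ.eq_empty_or_nonempty with he | ⟨A, hA⟩
    · simp [he]
    have hr : ∀ B ∈ ℬ, B.card = r := fun B hB => by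
      simpa using (h𝒜 (hℬ B hB)).2.2
    have hpos : 0 < A.card := by
      have := hmeet A hA A hA
      rw [Finset.inter_self] at this
      exact this.card_pos
    rw [hr A hA] at hpos
    exact_mod_cast card_le_card_shadow (m := r - 1)
      (fun B hB => by rw [hr B hB]; omega) hmeet
  have hunion : 𝒜 ⊆ 𝒜₀ ∪ 𝒜₁ := by
    intro A hA
    by_cases h : A.1 = ∅
    · exact Or.inl ⟨hA, h⟩
    · exact Or.inr ⟨hA, h⟩
  calc 𝒜.encard ≤ 𝒜₀.encard + 𝒜₁.encard :=
        (Set.encard_le_encard hunion).trans (Set.encard_union_le _ _)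
    _ ≤ ((ℬ.shadow : Finset (Finset W)) : Set (Finset W)).encard + (f '' 𝒜₁).encard :=
        add_le_add hcard hinj.encard_image.ge
    _ = (((ℬ.shadow : Finset (Finset W)) : Set (Finset W)) ∪ f '' 𝒜₁).encard :=
        (Set.encard_union_eq hdisj).symm
    _ ≤ 𝒯.encard := Set.encard_le_encard (Set.union_subset hsh hmaps)

end CyclePowerEKR

/-! ### Contracting an edge of the cycle -/

namespace CyclePowerEKR

/-- The part of Pascal's recurrence needed for stars: a member of the star of the shorter cycle is
kept, to a member of the star of the shortest cycle the vertex `m` is added. -/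
theorem jointStar_add_le {W : Type*} (H : SimpleGraph W) {m k : ℕ} (hm : k + 1 ≤ m) (r : ℕ) :
    (jointStar H (m + k) k r).encard + (jointStar H m k (r - 1)).encard
      ≤ (jointStar H (m + k + 1) k r).encard := by
  classical
  let f : Finset ℕ × Finset W → Finset ℕ × Finset W := fun A => (insert m A.1, A.2)
  have hlt : ∀ A ∈ jointStar H m k (r - 1), m ∉ A.1 := fun A hA h =>
    lt_irrefl _ (hA.1.1.1 m h)
  have hinj : Set.InjOn f (jointStar H m k (r - 1)) := by
    intro A hA B hB hAB
    obtain ⟨h1, h2⟩ := Prod.mk.inj hAB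
    have h3 := congrArg (fun P => P.erase m) h1
    simp only [Finset.erase_insert (hlt A hA), Finset.erase_insert (hlt B hB)] at h3
    exact Prod.ext h3 h2
  have hdisj : Disjoint (jointStar H (m + k) k r) (f '' jointStar H m k (r - 1)) := by
    rw [Set.disjoint_left]
    rintro _ hA ⟨B, hB, rfl⟩
    have := hA.1.1.2 0 hA.2 m (Finset.mem_insert_self _ _) (by omega)
    omega
  rw [← hinj.encard_image, ← Set.encard_union_eq hdisj]
  refine Set.encard_le_encard (Set.union_subset ?_ ?_)
  · rintro A ⟨⟨⟨hlt, hsep⟩, hind⟩, h0⟩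
    refine ⟨⟨⟨fun a ha => (hlt a ha).trans_le (by omega), fun a ha b hb hab => ?_⟩, hind⟩, h0⟩
    have := hsep a ha b hb hab
    omega
  · rintro _ ⟨A, hA, rfl⟩
    have hnot := hlt A hA
    obtain ⟨⟨⟨hlt, hsep⟩, hind, hcard⟩, h0⟩ := hA
    refine ⟨⟨⟨?_, ?_⟩, hind, ?_⟩, Finset.mem_insert_of_mem h0⟩
    · intro a ha
      rcases Finset.mem_insert.mp ha with rfl | ha
      · omega
      · have := hlt a ha
        omega
    · intro a ha b hb hab
      rcases Finset.mem_insert.mp ha with ha' | ha' <;>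
        rcases Finset.mem_insert.mp hb with hb' | hb'
      · omega
      · have := hlt b hb'
        omega
      · rcases Nat.eq_zero_or_pos a with ha0 | ha0
        · omega
        · have := hsep 0 h0 a ha' ha0
          have := hlt a ha'
          omega
      · have := hsep a ha' b hb' hab
        omega
    · have : 0 < A.1.card := Finset.card_pos.mpr ⟨0, h0⟩
      have h1 : (f A).1.card = A.1.card + 1 := Finset.card_insert_of_notMem hnot
      rw [h1]
      change A.1.card + 1 + A.2.card = r
      omega

/-- The members of `𝒜` that cannot be kept when the edge between the vertices `m + k` and `0` of the
cycle `0, …, m + k` is contracted: those that contain `m + k` and remain in `𝒜` when it is replaced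
with `0`, and those with two elements `m + a` and `a` at distance `k + 1` on either side of the
edge. -/
def blocked {W : Type*} (𝒜 : Set (Finset ℕ × Finset W)) (m k : ℕ) : Set (Finset ℕ × Finset W) :=
  {A | A ∈ 𝒜 ∧ ((m + k ∈ A.1 ∧ (insert 0 (A.1.erase (m + k)), A.2) ∈ 𝒜) ∨
    ∃ a ≤ k, a ∈ A.1 ∧ m + a ∈ A.1)}

/-- The two kinds of blocked members: in both, exactly one element is at least `m`. -/
theorem blocked_cases {W : Type*} {H : SimpleGraph W} {m k r : ℕ} (hk : 1 ≤ k)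
    (hm : k + 1 ≤ m) {𝒜 : Set (Finset ℕ × Finset W)} (h𝒜 : 𝒜 ⊆ jointFamily H (m + k + 1) k r)
    {A : Finset ℕ × Finset W} (hA : A ∈ blocked 𝒜 m k) :
    (m + k ∈ A.1 ∧ (insert 0 (A.1.erase (m + k)), A.2) ∈ 𝒜 ∧
      ∀ x ∈ A.1, x ≠ m + k → k < x ∧ x < m) ∨
    ∃ a ≤ k, a ∈ A.1 ∧ m + a ∈ A.1 ∧
      ∀ x ∈ A.1, x ≠ m + a → x = a ∨ a + k < x ∧ x + k < m + a := by
  obtain ⟨hA𝒜, ⟨h1, h2⟩ | ⟨a, hak, ha, hma⟩⟩ := hA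
  · left
    refine ⟨h1, h2, fun x hx hxn => ?_⟩
    have hx' : x ∈ insert 0 (A.1.erase (m + k)) := by simp [hx, hxn]
    have hsep := (h𝒜 hA𝒜).1
    have hsep' := (h𝒜 h2).1
    have h3 := hsep.1 x hx
    have h4 := hsep.2 x hx (m + k) h1 (by omega)
    have h5 := hsep'.2 0 (by simp) x hx' (by omega)
    omega
  · right
    refine ⟨a, hak, ha, hma, fun x hx hxn => ?_⟩
    have hsep := (h𝒜 hA𝒜).1
    have h3 := hsep.1 x hx
    rcases lt_trichotomy x a with h | h | h
    · have h4 := hsep.2 x hx (m + a) hma (by omega)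
      omega
    · exact Or.inl h
    · have h5 := hsep.2 a ha x hx h
      rcases lt_trichotomy x (m + a) with h' | h' | h'
      · have h6 := hsep.2 x hx (m + a) hma h'
        omega
      · exact absurd h' hxn
      · have h6 := hsep.2 (m + a) hma x hx h'
        omega

/-- Deletes the vertices `m, m + 1, …` from the part in the cycle. -/
def truncate {W : Type*} (m : ℕ) (A : Finset ℕ × Finset W) : Finset ℕ × Finset W :=
  (A.1.filter (· < m), A.2)

theorem truncate_mem_jointFamily {W : Type*} {H : SimpleGraph W} {m k r : ℕ} (hk : 1 ≤ k)
    (hm : k + 1 ≤ m) {𝒜 : Set (Finset ℕ × Finset W)} (h𝒜 : 𝒜 ⊆ jointFamily H (m + k + 1) k r)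
    {A : Finset ℕ × Finset W} (hA : A ∈ blocked 𝒜 m k) :
    truncate m A ∈ jointFamily H m k (r - 1) := by
  obtain ⟨hsep, hind, hcard⟩ := h𝒜 hA.1
  have hcases := blocked_cases hk hm h𝒜 hA
  refine ⟨⟨fun a ha => (Finset.mem_filter.mp ha).2, fun x hx y hy hxy => ?_⟩, hind, ?_⟩
  · obtain ⟨hx, hxm⟩ := Finset.mem_filter.mp hx
    obtain ⟨hy, hym⟩ := Finset.mem_filter.mp hy
    have h1 := hsep.2 x hx y hy hxy
    rcases hcases with ⟨hb, -, h⟩ | ⟨a, hak, -, -, h⟩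
    · have h2 := h x hx (by omega)
      have h3 := hsep.2 y hy (m + k) hb (by omega)
      omega
    · have h2 := h x hx (by omega)
      have h3 := h y hy (by omega)
      omega
  · obtain ⟨b, hb, hbm, hbu⟩ : ∃ b ∈ A.1, m ≤ b ∧ ∀ x ∈ A.1, x ≠ b → x < m := by
      rcases hcases with ⟨h1, -, h⟩ | ⟨a, hak, -, h1, h⟩
      · exact ⟨m + k, h1, by omega, fun x hx hxb => (h x hx hxb).2⟩
      · refine ⟨m + a, h1, by omega, fun x hx hxb => ?_⟩
        have := h x hx hxb
        omega
    have h1 : A.1.filter (· < m) = A.1.erase b := by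
      ext x
      simp only [Finset.mem_filter, Finset.mem_erase]
      constructor
      · rintro ⟨hx, hxm⟩
        exact ⟨by omega, hx⟩
      · rintro ⟨hxb, hx⟩
        exact ⟨hx, hbu x hx hxb⟩
    have h2 : (truncate m A).1.card + 1 = A.1.card := by
      change (A.1.filter (· < m)).card + 1 = A.1.card
      rw [h1, Finset.card_erase_add_one hb]
    change (truncate m A).1.card + A.2.card = r - 1
    omega

theorem truncate_injOn {W : Type*} {H : SimpleGraph W} {m k r : ℕ} (hk : 1 ≤ k)
    (hm : k + 1 ≤ m) {𝒜 : Set (Finset ℕ × Finset W)} (h𝒜 : 𝒜 ⊆ jointFamily H (m + k + 1) k r) :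
    Set.InjOn (truncate m) (blocked 𝒜 m k) := by
  intro A hA B hB hAB
  obtain ⟨h1, h2⟩ := Prod.mk.inj hAB
  refine Prod.ext ?_ h2
  have hiff : ∀ x < m, (x ∈ A.1 ↔ x ∈ B.1) := by
    intro x hx
    have := Finset.ext_iff.mp h1 x
    simpa [hx] using this
  have hsA := (h𝒜 hA.1).1
  have hsB := (h𝒜 hB.1).1
  have hdiff : ∀ b, b ∈ A.1 → b ∈ B.1 → (∀ x ∈ A.1, x ≠ b → x < m) →
      (∀ x ∈ B.1, x ≠ b → x < m) → A.1 = B.1 := by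
    intro b hbA hbB hA' hB'
    ext x
    by_cases hxb : x = b
    · simp [hxb, hbA, hbB]
    · exact ⟨fun h => (hiff x (hA' x h hxb)).mp h, fun h => (hiff x (hB' x h hxb)).mpr h⟩
  rcases blocked_cases hk hm h𝒜 hA with ⟨h3, -, h4⟩ | ⟨a, hak, ha, hma, h4⟩ <;>
    rcases blocked_cases hk hm h𝒜 hB with ⟨h3', -, h4'⟩ | ⟨a', hak', ha', hma', h4'⟩
  · exact hdiff (m + k) h3 h3' (fun x hx hn => (h4 x hx hn).2) (fun x hx hn => (h4' x hx hn).2)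
  · have := h4 a' ((hiff a' (by omega)).mpr ha') (by omega)
    omega
  · have := h4' a ((hiff a (by omega)).mp ha) (by omega)
    omega
  · have ha'A := (hiff a' (by omega)).mpr ha'
    have haa : a = a' := by
      rcases lt_trichotomy a a' with h | h | h
      · have := hsA.2 a ha a' ha'A h
        omega
      · exact h
      · have := hsA.2 a' ha'A a ha h
        omega
    subst haa
    refine hdiff (m + a) hma hma' (fun x hx hn => ?_) (fun x hx hn => ?_)
    · have := h4 x hx hn
      omega
    · have := h4' x hx hn
      omega

/-- Truncation preserves intersections between blocked members. Only two members that both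
contain `m + k` could meet in a deleted vertex alone. One of them is then of the kind that remains
in `𝒜` when `m + k` is replaced with `0`; the other one does not contain `0`, and meets the changed
set, so the two meet elsewhere. -/
theorem truncate_meets {W : Type*} {H : SimpleGraph W} {m k r : ℕ} (hk : 1 ≤ k)
    (hm : k + 1 ≤ m) {𝒜 : Set (Finset ℕ × Finset W)} (h𝒜 : 𝒜 ⊆ jointFamily H (m + k + 1) k r)
    (hint : ∀ A ∈ 𝒜, ∀ B ∈ 𝒜, Meets A B) {A B : Finset ℕ × Finset W}
    (hA : A ∈ blocked 𝒜 m k) (hB : B ∈ blocked 𝒜 m k) :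
    Meets (truncate m A) (truncate m B) := by
  have key : ∀ x, x ∈ A.1 → x ∈ B.1 → x < m → Meets (truncate m A) (truncate m B) :=
    fun x hx hx' hxm => Or.inl
      ⟨x, Finset.mem_filter.mpr ⟨hx, hxm⟩, Finset.mem_filter.mpr ⟨hx', hxm⟩⟩
  have hsA := (h𝒜 hA.1).1
  have hsB := (h𝒜 hB.1).1
  have swapA : (insert 0 (A.1.erase (m + k)), A.2) ∈ 𝒜 → 0 ∉ B.1 →
      (∀ x ∈ A.1, x ≠ m + k → k < x ∧ x < m) → Meets (truncate m A) (truncate m B) := by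
    intro hA' h0 h
    rcases hint _ hA' _ hB.1 with ⟨x, hx, hxB⟩ | hy
    · rcases Finset.mem_insert.mp hx with rfl | hx
      · exact absurd hxB h0
      · obtain ⟨hxn, hx⟩ := Finset.mem_erase.mp hx
        exact key x hx hxB (h x hx hxn).2
    · exact Or.inr hy
  have swapB : (insert 0 (B.1.erase (m + k)), B.2) ∈ 𝒜 → 0 ∉ A.1 →
      (∀ x ∈ B.1, x ≠ m + k → k < x ∧ x < m) → Meets (truncate m A) (truncate m B) := by
    intro hB' h0 h
    rcases hint _ hA.1 _ hB' with ⟨x, hxA, hx⟩ | hy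
    · rcases Finset.mem_insert.mp hx with rfl | hx
      · exact absurd hxA h0
      · obtain ⟨hxn, hx⟩ := Finset.mem_erase.mp hx
        exact key x hxA hx (h x hx hxn).2
    · exact Or.inr hy
  rcases blocked_cases hk hm h𝒜 hA with ⟨h3, hA', h4⟩ | ⟨a, hak, ha, hma, h4⟩ <;>
    rcases blocked_cases hk hm h𝒜 hB with ⟨h3', hB', h4'⟩ | ⟨a', hak', ha', hma', h4'⟩
  · refine swapA hA' (fun h => ?_) h4
    have := h4' 0 h (by omega)
    omega
  · by_cases hak : a' = k
    · subst hak
      refine swapA hA' (fun h => ?_) h4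
      have := hsB.2 0 h a' ha' (by omega)
      omega
    · rcases hint A hA.1 B hB.1 with ⟨x, hx, hx'⟩ | hy
      · refine key x hx hx' ?_
        by_cases hxn : x = m + k
        · have := h4' x hx' (by omega)
          omega
        · exact (h4 x hx hxn).2
      · exact Or.inr hy
  · by_cases haka : a = k
    · subst haka
      refine swapB hB' (fun h => ?_) h4'
      have := hsA.2 0 h a ha (by omega)
      omega
    · rcases hint A hA.1 B hB.1 with ⟨x, hx, hx'⟩ | hy
      · refine key x hx hx' ?_
        by_cases hxn : x = m + k
        · have := h4 x hx (by omega)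
          omega
        · exact (h4' x hx' hxn).2
      · exact Or.inr hy
  · by_cases haa : a = a'
    · subst haa
      exact key a ha ha' (by omega)
    · rcases hint A hA.1 B hB.1 with ⟨x, hx, hx'⟩ | hy
      · refine key x hx hx' ?_
        by_cases hxn : x = m + a
        · have := h4' x hx' (by omega)
          omega
        · have := h4 x hx hxn
          omega
      · exact Or.inr hy

/-- Contracts the edge between the vertices `b` and `0`: the vertex `b` is identified with `0`. -/
def contract {W : Type*} (b : ℕ) (A : Finset ℕ × Finset W) : Finset ℕ × Finset W :=
  (A.1.image fun j => if j = b then 0 else j, A.2)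

theorem contract_of_notMem {W : Type*} {b : ℕ} {A : Finset ℕ × Finset W} (h : b ∉ A.1) :
    contract b A = A := by
  refine Prod.ext ?_ rfl
  have h1 : ∀ x ∈ A.1, (if x = b then 0 else x) = id x := fun x hx =>
    if_neg (ne_of_mem_of_not_mem hx h)
  change A.1.image _ = A.1
  rw [Finset.image_congr (g := id) h1, Finset.image_id]

theorem contract_of_mem {W : Type*} {b : ℕ} {A : Finset ℕ × Finset W} (h : b ∈ A.1) :
    contract b A = (insert 0 (A.1.erase b), A.2) := by
  refine Prod.ext ?_ rfl
  change A.1.image _ = _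
  conv_lhs => rw [← Finset.insert_erase h]
  have h1 : ∀ x ∈ A.1.erase b, (if x = b then 0 else x) = id x := fun x hx =>
    if_neg (Finset.ne_of_mem_erase hx)
  rw [Finset.image_insert, if_pos rfl, Finset.image_congr (g := id) h1, Finset.image_id]

theorem Meets.contract {W : Type*} {A B : Finset ℕ × Finset W} (h : Meets A B) (b : ℕ) :
    Meets (contract b A) (contract b B) := by
  rcases h with ⟨x, hx, hx'⟩ | h
  · exact Or.inl ⟨_, Finset.mem_image_of_mem _ hx, Finset.mem_image_of_mem _ hx'⟩
  · exact Or.inr h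

theorem contract_mem_jointFamily {W : Type*} {H : SimpleGraph W} {m k r : ℕ} (hk : 1 ≤ k)
    (hm : k + 1 ≤ m) {𝒜 : Set (Finset ℕ × Finset W)}
    (h𝒜 : 𝒜 ⊆ jointFamily H (m + k + 1) k r) {A : Finset ℕ × Finset W} (hA : A ∈ 𝒜)
    (hA' : A ∉ blocked 𝒜 m k) : contract (m + k) A ∈ jointFamily H (m + k) k r := by
  obtain ⟨hsep, hind, hcard⟩ := h𝒜 hA
  have hno : ∀ a ≤ k, a ∈ A.1 → m + a ∉ A.1 := fun a hak ha hma =>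
    hA' ⟨hA, Or.inr ⟨a, hak, ha, hma⟩⟩
  -- The only pairs whose distance becomes too small are those excluded by `hno`.
  have hgap : ∀ x ∈ A.1, ∀ y ∈ A.1, y ≠ m + k → x < y → y + k < m + k + x := by
    intro x hx y hy hyn hxy
    have h1 := hsep.2 x hx y hy hxy
    have h2 := hsep.1 y hy
    by_contra hcon
    have h3 : y = m + x := by omega
    exact hno x (by omega) hx (h3 ▸ hy)
  by_cases hb : m + k ∈ A.1
  · have hmid : ∀ x ∈ A.1, x ≠ m + k → k < x ∧ x < m := by
      intro x hx hxn
      have h1 := hsep.1 x hx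
      have h2 := hsep.2 x hx (m + k) hb (by omega)
      have h3 : x ≠ k := fun e => hno k le_rfl (e ▸ hx) hb
      omega
    rw [contract_of_mem hb]
    refine ⟨⟨?_, ?_⟩, hind, ?_⟩
    · intro x hx
      rcases Finset.mem_insert.mp hx with rfl | hx
      · omega
      · obtain ⟨hxn, hx⟩ := Finset.mem_erase.mp hx
        have := hmid x hx hxn
        omega
    · intro x hx y hy hxy
      obtain ⟨hyn, hy⟩ : y ≠ m + k ∧ y ∈ A.1 := by
        rcases Finset.mem_insert.mp hy with rfl | hy
        · omega
        · exact Finset.mem_erase.mp hy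
      have h2 := hmid y hy hyn
      rcases Finset.mem_insert.mp hx with rfl | hx
      · omega
      · obtain ⟨hxn, hx⟩ := Finset.mem_erase.mp hx
        have h1 := hsep.2 x hx y hy hxy
        have h3 := hgap x hx y hy hyn hxy
        omega
    · have h0 : 0 ∉ A.1.erase (m + k) := by
        intro h
        have := hmid 0 (Finset.mem_of_mem_erase h) (by omega)
        omega
      change (insert 0 (A.1.erase (m + k))).card + A.2.card = r
      rw [Finset.card_insert_of_notMem h0, Finset.card_erase_add_one hb, hcard]
  · rw [contract_of_notMem hb]
    refine ⟨⟨fun x hx => ?_, fun x hx y hy hxy => ?_⟩, hind, hcard⟩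
    · have h1 := hsep.1 x hx
      have h2 : x ≠ m + k := fun e => hb (e ▸ hx)
      omega
    · have h1 := hsep.2 x hx y hy hxy
      have h3 := hgap x hx y hy (fun e => hb (e ▸ hy)) hxy
      omega

theorem contract_injOn {W : Type*} {H : SimpleGraph W} {m k r : ℕ} (hk : 1 ≤ k)
    {𝒜 : Set (Finset ℕ × Finset W)} (h𝒜 : 𝒜 ⊆ jointFamily H (m + k + 1) k r) :
    Set.InjOn (contract (m + k)) (𝒜 \ blocked 𝒜 m k) := by
  rintro A ⟨hA, hA'⟩ B ⟨hB, hB'⟩ hAB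
  have h0 : ∀ A ∈ 𝒜, m + k ∈ A.1 → 0 ∉ A.1.erase (m + k) := by
    intro A hA hb h
    have := (h𝒜 hA).1.2 0 (Finset.mem_of_mem_erase h) (m + k) hb (by omega)
    omega
  by_cases hbA : m + k ∈ A.1 <;> by_cases hbB : m + k ∈ B.1
  · rw [contract_of_mem hbA, contract_of_mem hbB] at hAB
    obtain ⟨h1, h2⟩ := Prod.mk.inj hAB
    have h3 := congrArg (fun P => insert (m + k) (P.erase 0)) h1
    simp only [Finset.erase_insert (h0 A hA hbA), Finset.erase_insert (h0 B hB hbB),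
      Finset.insert_erase hbA, Finset.insert_erase hbB] at h3
    exact Prod.ext h3 h2
  · rw [contract_of_mem hbA, contract_of_notMem hbB] at hAB
    exact absurd ⟨hA, Or.inl ⟨hbA, hAB ▸ hB⟩⟩ hA'
  · rw [contract_of_notMem hbA, contract_of_mem hbB] at hAB
    exact absurd ⟨hB, Or.inl ⟨hbB, hAB ▸ hA⟩⟩ hB'
  · rwa [contract_of_notMem hbA, contract_of_notMem hbB] at hAB

/-- The theorem in coordinates, with the rotation `ρ` of `H` as the only information on `H`. -/
theorem encard_le_jointStar {W : Type*} [Finite W] {H : SimpleGraph W} {k : ℕ} (hk : 1 ≤ k)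
    (ρ : Equiv.Perm W) (hρ : ∀ a b, H.Adj (ρ a) (ρ b) ↔ H.Adj a b)
    (hadj : ∀ v j, 1 ≤ j → j ≤ 2 * k + 1 → H.Adj v ((ρ ^ j) v)) (n : ℕ) (hn : 1 ≤ n) :
    ∀ (r : ℕ) (𝒜 : Set (Finset ℕ × Finset W)), 𝒜 ⊆ jointFamily H n k r →
      (∀ A ∈ 𝒜, ∀ B ∈ 𝒜, Meets A B) → 𝒜.encard ≤ (jointStar H n k r).encard := by
  induction n using Nat.strong_induction_on with
  | _ n ih =>
    intro r 𝒜 h𝒜 hint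
    rcases le_or_gt n (2 * k + 1) with hnk | hnk
    · exact encard_le_jointStar_of_le ρ hρ hadj hn hnk h𝒜 hint
    obtain ⟨m, rfl, hm⟩ : ∃ m, n = m + k + 1 ∧ k + 1 ≤ m := ⟨n - k - 1, by omega, by omega⟩
    have h1 : (contract (m + k) '' (𝒜 \ blocked 𝒜 m k)).encard
        ≤ (jointStar H (m + k) k r).encard := by
      refine ih (m + k) (by omega) (by omega) r _ ?_ ?_
      · rintro _ ⟨A, ⟨hA, hA'⟩, rfl⟩
        exact contract_mem_jointFamily hk hm h𝒜 hA hA'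
      · rintro _ ⟨A, ⟨hA, -⟩, rfl⟩ _ ⟨B, ⟨hB, -⟩, rfl⟩
        exact (hint A hA B hB).contract _
    have h2 : (truncate m '' blocked 𝒜 m k).encard ≤ (jointStar H m k (r - 1)).encard := by
      refine ih m (by omega) (by omega) (r - 1) _ ?_ ?_
      · rintro _ ⟨A, hA, rfl⟩
        exact truncate_mem_jointFamily hk hm h𝒜 hA
      · rintro _ ⟨A, hA, rfl⟩ _ ⟨B, hB, rfl⟩
        exact truncate_meets hk hm h𝒜 hint hA hB
    rw [(contract_injOn hk h𝒜).encard_image] at h1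
    rw [(truncate_injOn hk hm h𝒜).encard_image] at h2
    calc 𝒜.encard ≤ (𝒜 \ blocked 𝒜 m k).encard + (blocked 𝒜 m k).encard :=
          Set.encard_le_encard_sdiff_add_encard _ _
      _ ≤ _ := add_le_add h1 h2
      _ ≤ _ := jointStar_add_le H hm r

end CyclePowerEKR

/-! ### Powers of cycles in coordinates -/

namespace CyclePowerEKR

/-- The numbers `a, b < n` are distinct and at distance at most `k` on the cycle `0, …, n - 1`. -/
def Near (n k a b : ℕ) : Prop :=
  (a < b ∧ (b ≤ a + k ∨ a + n ≤ b + k)) ∨ (b < a ∧ (a ≤ b + k ∨ b + n ≤ a + k))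

theorem cycleGraph_adj_iff_near {n : ℕ} (hn : 3 ≤ n) (a b : Fin n) :
    (SimpleGraph.cycleGraph n).Adj a b ↔ Near n 1 a b := by
  rw [SimpleGraph.cycleGraph_adj']
  have ha := a.isLt
  have hb := b.isLt
  unfold Near
  rcases lt_trichotomy a b with h | h | h
  · rw [Fin.coe_sub_iff_lt.mpr h, Fin.coe_sub_iff_le.mpr h.le]
    have := Fin.lt_def.mp h
    omega
  · subst h
    rw [Fin.coe_sub_iff_le.mpr le_rfl]
    omega
  · rw [Fin.coe_sub_iff_lt.mpr h, Fin.coe_sub_iff_le.mpr h.le]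
    have := Fin.lt_def.mp h
    omega

theorem Near.of_walk {V : Type*} {C : SimpleGraph V} {n : ℕ} (hn : 3 ≤ n)
    (e : C ≃g SimpleGraph.cycleGraph n) {u v : V} (p : C.Walk u v) :
    u = v ∨ Near n p.length (e u) (e v) := by
  induction p with
  | nil => exact Or.inl rfl
  | @cons u v w h p ih =>
    have h1 := (cycleGraph_adj_iff_near hn _ _).mp (e.map_adj_iff.mpr h)
    have hu := (e u).isLt
    have hv := (e v).isLt
    have hw := (e w).isLt
    rw [SimpleGraph.Walk.length_cons]
    by_cases huw : u = w
    · exact Or.inl huw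
    · have huw' : (e u : ℕ) ≠ e w := fun h => huw (e.injective (Fin.ext h))
      right
      rcases ih with rfl | ih
      · unfold Near at *
        omega
      · unfold Near at *
        omega

theorem exists_walk_add {V : Type*} {C : SimpleGraph V} {n : ℕ} (hn : 3 ≤ n)
    (e : C ≃g SimpleGraph.cycleGraph n) (d : ℕ) :
    ∀ u v : V, (e v : ℕ) = e u + d → ∃ p : C.Walk u v, p.length = d := by
  induction d with
  | zero =>
    intro u v h
    obtain rfl : v = u := e.injective (Fin.ext h)
    exact ⟨.nil, rfl⟩
  | succ d ih =>
    intro u v h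
    have hv := (e v).isLt
    let w : V := e.symm ⟨e u + d, by omega⟩
    have hw : (e w : ℕ) = e u + d := by simp [w]
    obtain ⟨p, hp⟩ := ih u w hw
    have hadj : C.Adj w v := by
      rw [← e.map_adj_iff, cycleGraph_adj_iff_near hn]
      unfold Near
      omega
    exact ⟨p.concat hadj, by rw [SimpleGraph.Walk.length_concat, hp]⟩

theorem exists_walk_of_lt_of_near {V : Type*} {C : SimpleGraph V} {n k : ℕ} (hn : 3 ≤ n)
    (e : C ≃g SimpleGraph.cycleGraph n) {u v : V} (huv : (e u : ℕ) < e v)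
    (h : Near n k (e u) (e v)) : ∃ p : C.Walk u v, p.length ≤ k := by
  have hv := (e v).isLt
  unfold Near at h
  by_cases h1 : (e v : ℕ) ≤ e u + k
  · obtain ⟨p, hp⟩ := exists_walk_add hn e (e v - e u) u v (by omega)
    exact ⟨p, by omega⟩
  · -- The walk around the other way passes through the vertices `0` and `n - 1`.
    let x : V := e.symm ⟨0, by omega⟩
    let y : V := e.symm ⟨n - 1, by omega⟩
    have hx : (e x : ℕ) = 0 := by simp [x]
    have hy : (e y : ℕ) = n - 1 := by simp [y]
    obtain ⟨p, hp⟩ := exists_walk_add hn e (e u) x u (by omega)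
    obtain ⟨q, hq⟩ := exists_walk_add hn e (n - 1 - e v) v y (by omega)
    have hadj : C.Adj x y := by
      rw [← e.map_adj_iff, cycleGraph_adj_iff_near hn]
      unfold Near
      omega
    refine ⟨p.reverse.append (.cons hadj q.reverse), ?_⟩
    simp only [SimpleGraph.Walk.length_append, SimpleGraph.Walk.length_reverse,
      SimpleGraph.Walk.length_cons]
    omega

theorem Near.symm {n k a b : ℕ} (h : Near n k a b) : Near n k b a := Or.symm h

theorem power_adj_iff_near {V : Type*} {C : SimpleGraph V} {n : ℕ} (hn : 3 ≤ n)
    (e : C ≃g SimpleGraph.cycleGraph n) (k : ℕ) (u v : V) :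
    (power C k).Adj u v ↔ Near n k (e u) (e v) := by
  constructor
  · rintro ⟨h1, h2⟩
    obtain ⟨p, hp⟩ := SimpleGraph.exists_walk_of_dist_ne_zero (Nat.one_le_iff_ne_zero.mp h1)
    rcases Near.of_walk hn e p with rfl | h
    · simp at h1
    · unfold Near at *
      omega
  · intro h
    obtain ⟨p, hp⟩ : ∃ p : C.Walk u v, p.length ≤ k := by
      rcases lt_or_ge (e u : ℕ) (e v) with huv | huv
      · exact exists_walk_of_lt_of_near hn e huv h
      · have huv' : (e v : ℕ) < e u := by
          unfold Near at h
          omega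
        obtain ⟨p, hp⟩ := exists_walk_of_lt_of_near hn e huv' h.symm
        exact ⟨p.reverse, by rwa [SimpleGraph.Walk.length_reverse]⟩
    have hne : u ≠ v := by
      rintro rfl
      unfold Near at h
      omega
    exact ⟨p.reachable.pos_dist_of_ne hne, (SimpleGraph.dist_le p).trans hp⟩

/-- The translation by `d` as an automorphism of the cycle. -/
def cycleTranslation (n : ℕ) (d : Fin (n + 2)) :
    SimpleGraph.cycleGraph (n + 2) ≃g SimpleGraph.cycleGraph (n + 2) where
  toEquiv := Equiv.addRight d
  map_rel_iff' := by simp [SimpleGraph.cycleGraph_adj]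

theorem IsCycle.exists_iso_eq_zero {V : Type*} {C : SimpleGraph V} (hC : IsCycle C) (x : V) :
    ∃ n, 3 ≤ n ∧ ∃ e : C ≃g SimpleGraph.cycleGraph n, (e x : ℕ) = 0 := by
  obtain ⟨n, hn, ⟨e⟩⟩ := hC
  obtain ⟨n, rfl⟩ : ∃ m, n = m + 2 := ⟨n - 2, by omega⟩
  refine ⟨n + 2, hn, e.trans (cycleTranslation n (-e x)), ?_⟩
  simp [cycleTranslation]

theorem IsCycle.nonempty {V : Type*} {C : SimpleGraph V} (hC : IsCycle C) : Nonempty V := by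
  obtain ⟨n, hn, ⟨e⟩⟩ := hC
  exact ⟨e.symm ⟨0, by omega⟩⟩

theorem IsCycle.finite {V : Type*} {C : SimpleGraph V} (hC : IsCycle C) : Finite V := by
  obtain ⟨n, -, ⟨e⟩⟩ := hC
  exact Finite.of_equiv _ e.symm.toEquiv

/-- A clique of a cycle power that is not a complete graph has at most `k + 1` vertices. When it
contains `0`, its other elements are among `1, …, k` and `n - k, …, n - 1`, and
it contains at most one of `d` and `d + (n - k - 1)`. -/
theorem card_le_of_isClique_power {V : Type*} {C : SimpleGraph V} {n k : ℕ} (hn : 3 ≤ n)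
    (hnk : 2 * k + 2 ≤ n) (e : C ≃g SimpleGraph.cycleGraph n) {S : Finset V} {x : V} (hx : x ∈ S)
    (hex : (e x : ℕ) = 0) (hS : (power C k).IsClique (S : Set V)) : S.card ≤ k + 1 := by
  let f : V → ℕ := fun v => if (e v : ℕ) ≤ k then e v else e v - (n - k - 1)
  have hfar : ∀ v ∈ S, (e v : ℕ) ≤ k ∨ n ≤ e v + k := by
    intro v hv
    by_cases hvx : x = v
    · subst hvx
      omega
    · have h := (power_adj_iff_near hn e k x v).mp (hS hx hv hvx)
      unfold Near at h
      omega
  rw [← Finset.card_range (k + 1)]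
  refine Finset.card_le_card_of_injOn f (fun v hv => ?_) (fun u hu v hv huv => ?_)
  · have h1 := hfar v hv
    have h2 := (e v).isLt
    simp only [f, Finset.coe_range, Set.mem_Iio]
    split_ifs <;> omega
  · by_contra hne
    have h := (power_adj_iff_near hn e k u v).mp (hS hu hv hne)
    have h1 := hfar u hu
    have h2 := hfar v hv
    have h3 := (e u).isLt
    have h4 := (e v).isLt
    unfold Near at h
    simp only [f] at huv
    split_ifs at huv <;> omega

/-- If the clique number of a cycle power exceeds `K`, then the rotation of the cycle by one vertex
is an automorphism of the power whose iterates up to the `K`-th move every vertex to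
a neighbour. -/
theorem IsCycle.exists_rotation {V : Type*} {C : SimpleGraph V} (hC : IsCycle C) {k K : ℕ}
    (hK : K < (power C k).cliqueNum) :
    ∃ ρ : Equiv.Perm V, (∀ a b, (power C k).Adj (ρ a) (ρ b) ↔ (power C k).Adj a b) ∧
      ∀ v j, 1 ≤ j → j ≤ K → (power C k).Adj v ((ρ ^ j) v) := by
  have := hC.finite
  obtain ⟨S, hS⟩ := (power C k).exists_isNClique_cliqueNum
  have hSK : K < S.card := hS.card_eq ▸ hK
  obtain ⟨x, hx⟩ : S.Nonempty := Finset.card_pos.mp (by omega)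
  obtain ⟨n, hn, e, hex⟩ := hC.exists_iso_eq_zero x
  have hSn : S.card ≤ n := by
    rw [← Finset.card_map e.toEquiv.toEmbedding]
    exact (Finset.card_le_univ _).trans (Fintype.card_fin n).le
  -- Either the power is complete, or the iterates up to the `K`-th move by at most `k`.
  have hKk : n ≤ 2 * k + 1 ∨ K ≤ k := by
    rcases le_or_gt n (2 * k + 1) with h | h
    · exact Or.inl h
    · have := card_le_of_isClique_power hn h e hx hex hS.isClique
      omega
  -- `cycleTranslation` is stated for `n + 2` vertices.
  obtain ⟨n, rfl⟩ : ∃ m, n = m + 2 := ⟨n - 2, by omega⟩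
  let ρ : C ≃g C := (e.trans (cycleTranslation n 1)).trans e.symm
  have hρ : ∀ v, e (ρ v) = e v + 1 := by
    intro v
    simp [ρ, cycleTranslation]
  have hρj : ∀ (j : ℕ) v, (e ((ρ.toEquiv ^ j) v) : ℕ) = (e v + j) % (n + 2) := by
    intro j v
    induction j with
    | zero => simp [Nat.mod_eq_of_lt (e v).isLt]
    | succ j ih =>
      rw [pow_succ', Equiv.Perm.mul_apply]
      change (e (ρ _) : ℕ) = _
      rw [hρ, Fin.val_add, ih, Fin.val_one, Nat.mod_add_mod, add_assoc]
  refine ⟨ρ.toEquiv, fun a b => ?_, fun v j hj1 hj => ?_⟩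
  · rw [power_adj_iff_near hn e, power_adj_iff_near hn (ρ.trans e)]
    rfl
  · rw [power_adj_iff_near hn e, hρj]
    have hv := (e v).isLt
    rcases lt_or_ge (e v + j : ℕ) (n + 2) with h | h
    · rw [Nat.mod_eq_of_lt h]
      unfold Near
      omega
    · rw [Nat.mod_eq_sub_mod h, Nat.mod_eq_of_lt (by omega)]
      unfold Near
      omega

/-! ### Disjoint unions -/

theorem disjointUnion_adj {ι : Type*} {V : ι → Type*} (G : ∀ i, SimpleGraph (V i)) {i : ι}
    {a b : V i} : (disjointUnion G).Adj ⟨i, a⟩ ⟨i, b⟩ ↔ (G i).Adj a b := by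
  rw [disjointUnion, SimpleGraph.iSup_adj]
  constructor
  · rintro ⟨j, h⟩
    rw [SimpleGraph.map_adj] at h
    obtain ⟨a', b', h, h1, h2⟩ := h
    cases h1
    cases h2
    exact h
  · exact fun h => ⟨i, (SimpleGraph.map_adj _ _ _ _).mpr ⟨a, b, h, rfl, rfl⟩⟩

theorem fst_eq_of_disjointUnion_adj {ι : Type*} {V : ι → Type*} (G : ∀ i, SimpleGraph (V i))
    {x y : Σ i, V i} (h : (disjointUnion G).Adj x y) : x.1 = y.1 := by
  rw [disjointUnion, SimpleGraph.iSup_adj] at h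
  obtain ⟨j, h⟩ := h
  rw [SimpleGraph.map_adj] at h
  obtain ⟨a, b, -, rfl, rfl⟩ := h
  rfl

theorem exists_rotation_disjointUnion {ι : Type*} {V : ι → Type*} (G : ∀ i, SimpleGraph (V i))
    {K : ℕ} (hG : ∀ i, ∃ ρ : Equiv.Perm (V i), (∀ a b, (G i).Adj (ρ a) (ρ b) ↔ (G i).Adj a b) ∧
      ∀ v j, 1 ≤ j → j ≤ K → (G i).Adj v ((ρ ^ j) v)) :
    ∃ ρ : Equiv.Perm (Σ i, V i),
      (∀ a b, (disjointUnion G).Adj (ρ a) (ρ b) ↔ (disjointUnion G).Adj a b) ∧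
      ∀ v j, 1 ≤ j → j ≤ K → (disjointUnion G).Adj v ((ρ ^ j) v) := by
  choose ρ hρ hρK using hG
  have hpow : ∀ (j : ℕ) i (v : V i),
      ((Equiv.sigmaCongrRight ρ : Equiv.Perm (Σ i, V i)) ^ j) ⟨i, v⟩ = ⟨i, (ρ i ^ j) v⟩ := by
    intro j i v
    induction j with
    | zero => rfl
    | succ j ih =>
      rw [pow_succ', Equiv.Perm.mul_apply, ih, pow_succ', Equiv.Perm.mul_apply]
      rfl
  refine ⟨Equiv.sigmaCongrRight ρ, ?_, ?_⟩
  · rintro ⟨i, a⟩ ⟨j, b⟩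
    by_cases hij : i = j
    · subst hij
      rw [disjointUnion_adj G, ← hρ]
      exact disjointUnion_adj G
    · exact ⟨fun h => absurd (fst_eq_of_disjointUnion_adj G h) hij,
        fun h => absurd (fst_eq_of_disjointUnion_adj G h) hij⟩
  · rintro ⟨i, v⟩ j hj1 hj
    rw [hpow, disjointUnion_adj]
    exact hρK i v j hj1 hj

/-! ### Stars centred on the distinguished cycle -/

/-- The parts of a vertex set of a disjoint union in the two graphs, the first part in
coordinates. -/
def splitCoords {V W : Type*} {n : ℕ} (φ : V ≃ Fin n) (A : Finset (V ⊕ W)) :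
    Finset ℕ × Finset W :=
  (A.toLeft.map (φ.toEmbedding.trans Fin.valEmbedding), A.toRight)

theorem mem_splitCoords_fst {V W : Type*} {n : ℕ} {φ : V ≃ Fin n} {A : Finset (V ⊕ W)} {a : ℕ} :
    a ∈ (splitCoords φ A).1 ↔ ∃ v, Sum.inl v ∈ A ∧ (φ v : ℕ) = a := by
  simp [splitCoords]

theorem splitCoords_injective {V W : Type*} {n : ℕ} (φ : V ≃ Fin n) :
    Function.Injective (splitCoords (W := W) φ) := by
  intro A B h
  obtain ⟨h1, h2⟩ := Prod.mk.inj h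
  have h3 := Finset.map_injective _ h1
  rw [← Finset.toLeft_disjSum_toRight (u := A), ← Finset.toLeft_disjSum_toRight (u := B), h3, h2]

theorem splitCoords_surjOn {V W : Type*} {n : ℕ} (φ : V ≃ Fin n) {B : Finset ℕ × Finset W}
    (hB : ∀ a ∈ B.1, a < n) : ∃ A : Finset (V ⊕ W), splitCoords φ A = B := by
  classical
  let P : Finset V := B.1.attach.image fun a => φ.symm ⟨a.1, hB a.1 a.2⟩
  refine ⟨P.disjSum B.2, Prod.ext ?_ (by simp [splitCoords])⟩
  ext a
  rw [mem_splitCoords_fst]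
  constructor
  · rintro ⟨v, hv, rfl⟩
    simp only [Finset.inl_mem_disjSum, P, Finset.mem_image, Finset.mem_attach, true_and] at hv
    obtain ⟨a, rfl⟩ := hv
    simp
  · intro ha
    refine ⟨φ.symm ⟨a, hB a ha⟩, ?_, by simp⟩
    simp only [Finset.inl_mem_disjSum, P, Finset.mem_image, Finset.mem_attach, true_and]
    exact ⟨⟨a, ha⟩, rfl⟩

theorem splitCoords_mem_jointFamily_iff {V W : Type*} {C : SimpleGraph V} {H : SimpleGraph W}
    {n k r : ℕ} (φ : V ≃ Fin n) (hφ : ∀ u v, C.Adj u v ↔ Near n k (φ u) (φ v))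
    (A : Finset (V ⊕ W)) :
    splitCoords φ A ∈ jointFamily H n k r ↔ A ∈ indepFamily (C ⊕g H) r := by
  have hcard : (splitCoords φ A).1.card + (splitCoords φ A).2.card = A.card := by
    simp [splitCoords, Finset.card_toLeft_add_card_toRight]
  constructor
  · rintro ⟨hsep, hind, hr⟩
    refine ⟨?_, hcard ▸ hr⟩
    rintro (u | u) hu (v | v) hv huv hadj
    · rw [SimpleGraph.sum_adj_inl, hφ] at hadj
      have hu' := (mem_splitCoords_fst (φ := φ)).mpr ⟨u, hu, rfl⟩
      have hv' := (mem_splitCoords_fst (φ := φ)).mpr ⟨v, hv, rfl⟩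
      have h1 := hsep.2 _ hu' _ hv'
      have h2 := hsep.2 _ hv' _ hu'
      unfold Near at hadj
      omega
    · simp at hadj
    · simp at hadj
    · rw [SimpleGraph.sum_adj_inr] at hadj
      refine hind ?_ ?_ hadj.ne hadj
      · simpa [splitCoords] using hu
      · simpa [splitCoords] using hv
  · rintro ⟨hind, hr⟩
    refine ⟨⟨fun a ha => ?_, fun a ha b hb hab => ?_⟩, ?_, hcard.trans hr⟩
    · obtain ⟨v, -, rfl⟩ := mem_splitCoords_fst.mp ha
      exact (φ v).isLt
    · obtain ⟨u, hu, rfl⟩ := mem_splitCoords_fst.mp ha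
      obtain ⟨v, hv, rfl⟩ := mem_splitCoords_fst.mp hb
      have huv : u ≠ v := by
        rintro rfl
        omega
      have h : ¬ (C ⊕g H).Adj (.inl u) (.inl v) := hind hu hv (by simpa using huv)
      rw [SimpleGraph.sum_adj_inl, hφ] at h
      unfold Near at h
      omega
    · intro u hu v hv huv
      have h : ¬ (C ⊕g H).Adj (.inr u) (.inr v) := hind (by simpa [splitCoords] using hu)
        (by simpa [splitCoords] using hv) (by simpa using huv)
      rwa [SimpleGraph.sum_adj_inr] at h

theorem isLargestIntersecting_starAt_inl {V W : Type*} [Finite W] {C : SimpleGraph V}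
    (hC : IsCycle C) {H : SimpleGraph W} {k : ℕ} (hk : 1 ≤ k)
    (ρ : Equiv.Perm W) (hρ : ∀ a b, H.Adj (ρ a) (ρ b) ↔ H.Adj a b)
    (hadj : ∀ v j, 1 ≤ j → j ≤ 2 * k + 1 → H.Adj v ((ρ ^ j) v)) (r : ℕ) (x : V) :
    IsLargestIntersecting (indepFamily (power C k ⊕g H) r)
      (starAt (indepFamily (power C k ⊕g H) r) (Sum.inl x)) := by
  refine ⟨fun A hA => hA.1, fun A hA B hB => ⟨_, hA.2, hB.2⟩, fun ℬ hℬ hint => ?_⟩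
  obtain ⟨n, hn, e, hex⟩ := hC.exists_iso_eq_zero x
  have hφ := power_adj_iff_near hn e k
  have hmem := splitCoords_mem_jointFamily_iff (H := H) (r := r) e.toEquiv hφ
  have hle : (splitCoords e.toEquiv '' ℬ).encard ≤ (jointStar H n k r).encard := by
    refine encard_le_jointStar hk ρ hρ hadj n (by omega) r _ ?_ ?_
    · rintro _ ⟨A, hA, rfl⟩
      exact (hmem A).mpr (hℬ hA)
    · rintro _ ⟨A, hA, rfl⟩ _ ⟨B, hB, rfl⟩
      obtain ⟨v | v, hvA, hvB⟩ := hint A hA B hB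
      · exact Or.inl ⟨_, mem_splitCoords_fst.mpr ⟨v, hvA, rfl⟩,
          mem_splitCoords_fst.mpr ⟨v, hvB, rfl⟩⟩
      · exact Or.inr ⟨v, by simpa [splitCoords] using hvA, by simpa [splitCoords] using hvB⟩
  have hstar : jointStar H n k r ⊆
      splitCoords e.toEquiv '' starAt (indepFamily (power C k ⊕g H) r) (Sum.inl x) := by
    rintro B ⟨hB, h0⟩
    obtain ⟨A, rfl⟩ := splitCoords_surjOn e.toEquiv hB.1.1
    refine ⟨A, ⟨(hmem A).mp hB, ?_⟩, rfl⟩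
    obtain ⟨v, hv, hv0⟩ := mem_splitCoords_fst.mp h0
    have hvx : v = x := e.injective (Fin.ext (hv0.trans hex.symm))
    exact hvx ▸ hv
  rw [(splitCoords_injective _).encard_image] at hle
  refine hle.trans ((Set.encard_le_encard hstar).trans ?_)
  rw [(splitCoords_injective _).encard_image]

end CyclePowerEKR

theorem mainTheorem2 {V₀ : Type*} {s : ℕ} {V : Fin s → Type*}
    (C₀ : SimpleGraph V₀) (hC₀ : CyclePowerEKR.IsCycle C₀)
    (C : ∀ i, SimpleGraph (V i)) (hC : ∀ i, CyclePowerEKR.IsCycle (C i))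
    (k₀ : ℕ) (hk₀ : 1 ≤ k₀) (k : Fin s → ℕ)
    (hω : ∀ i, 2 * k₀ + 1 < (CyclePowerEKR.power (C i) (k i)).cliqueNum)
    (G : SimpleGraph (V₀ ⊕ Σ i, V i))
    (hG : G = CyclePowerEKR.power C₀ k₀ ⊕g
      CyclePowerEKR.disjointUnion fun i => CyclePowerEKR.power (C i) (k i))
    (r : ℕ) (hr : 1 ≤ r) (hrα : r ≤ G.indepNum) :
    CyclePowerEKR.IsEKR G r ∧
      ∀ x : V₀, CyclePowerEKR.IsLargestIntersecting (CyclePowerEKR.indepFamily G r)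
        (CyclePowerEKR.starAt (CyclePowerEKR.indepFamily G r) (Sum.inl x)) := by
  subst hG
  have := fun i => (hC i).finite
  obtain ⟨ρ, hρ, hadj⟩ := CyclePowerEKR.exists_rotation_disjointUnion
    (fun i => CyclePowerEKR.power (C i) (k i)) fun i => (hC i).exists_rotation (hω i)
  have hstar := fun x =>
    CyclePowerEKR.isLargestIntersecting_starAt_inl hC₀ hk₀ ρ hρ hadj r x
  obtain ⟨x⟩ := hC₀.nonempty
  exact ⟨⟨Sum.inl x, hstar x⟩, hstar⟩
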